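/- Let $N,M\ge 0$ be integers and let $\mathcal H=L^2(\mathbb R^N)$ be the Hilbert space of $N$ bosonic modes, with phase space $\mathbb R^{2N}$, canonical coordinates ${\bf x}=(q_1,p_1,\dots,q_N,p_N)^T$ and ${\bf\Omega}=\bigoplus_{j=1}^N\begin{pmatrix}0&1\\-1&0\end{pmatrix}$. Let $W({\bf x})=e^{-i{\bf x}^T{\bf\Omega R}}$, ${\bf R}=(Q_1,P_1,\dots,Q_N,P_N)^T$, be the Weyl operators, i.e. $(W({\bf x})\psi)(t)=e^{i(p\cdot t-q\cdot p/2)}\psi(t-q)$ for $q=(q_1,\dots,q_N)$, $p=(p_1,\dots,p_N)$. An observable is a map $\mathsf E$ from the Borel sets of $\mathbb R^M$ to the bounded operators on $\mathcal H$ with $\mathsf E(X)\ge 0$, $\mathsf E(\mathbb R^M)=I$, that is $\sigma$-additive in the weak operator topology. It is a Gaussian observable with parameters $({\bf A}_0,{\bf B}_0,{\bf v}_0)$, where ${\bf A}_0$ is a real $2N\times M$ matrix, ${\bf B}_0$ a real $M\times M$ matrix and ${\bf v}_0\in\mathbb R^M$, if ${\bf B}_0-i{\bf A}_0^T{\bf\Omega}{\bf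 A}_0\ge 0$ and $$\int e^{i{\bf p}^T{\bf x}}\,\mathsf E(d{\bf x})=e^{-\frac14{\bf p}^T{\bf B}_0{\bf p}-i{\bf v}_0^T{\bf p}}\,W({\bf A}_0{\bf p})\qquad\text{for all }{\bf p}\in\mathbb R^M$$ (the operator integral being understood weakly). It is informationally complete if any two states (positive operators of trace one) $\rho,\sigma$ on $\mathcal H$ with $\operatorname{tr}[\rho\,\mathsf E(X)]=\operatorname{tr}[\sigma\,\mathsf E(X)]$ for all Borel sets $X\subset\mathbb R^M$ are equal. Then a Gaussian observable $\mathsf E$ with parameters $({\bf A}_0,{\bf B}_0,{\bf v}_0)$ is informationally complete if and only if $\operatorname{rank}{\bf A}_0=2N$. -/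

import Mathlib

open MeasureTheory
open scoped Matrix Kronecker ENNReal InnerProductSpace ComplexOrder

noncomputable section

namespace GaussianIC

/-! ### Trace and states -/

section Trace

variable {H : Type*} [NormedAddCommGroup H] [InnerProductSpace ℂ H] [CompleteSpace H]

/-- Index set of a fixed orthonormal (Hilbert) basis of `H`. -/
def basisIndex (H : Type*) [NormedAddCommGroup H] [InnerProductSpace ℂ H] [CompleteSpace H] :
    Set H :=
  (exists_hilbertBasis ℂ H).choose

/-- A fixed orthonormal (Hilbert) basis of `H`. -/
def basis (H : Type*) [NormedAddCommGroup H] [InnerProductSpace ℂ H] [CompleteSpace H] :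
    HilbertBasis (basisIndex H) ℂ H :=
  (exists_hilbertBasis ℂ H).choose_spec.choose

/-- The trace `tr T = ∑ᵢ ⟨eᵢ, T eᵢ⟩`. It is only used for positive operators and for
trace class operators, where it does not depend on the orthonormal basis. -/
def trace (T : H →L[ℂ] H) : ℂ :=
  ∑' i, ⟪basis H i, T (basis H i)⟫_ℂ

/-- States (density operators): positive trace class operators with trace one. -/
structure IsState (ρ : H →L[ℂ] H) : Prop where
  isPositive : ρ.IsPositive
  summable : Summable fun i => ⟪basis H i, ρ (basis H i)⟫_ℂ
  trace_eq_one : trace ρ = 1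

end Trace

/-! ### Observables -/

/-- An observable (POVM) on the Borel sets of `ℝ^M` with values in the bounded operators on `H`.
The value on sets that are not Borel is irrelevant and never used. -/
structure Observable (M : ℕ) (H : Type*) [NormedAddCommGroup H] [InnerProductSpace ℂ H] where
  /-- the operator `E(X)` -/
  toFun : Set (Fin M → ℝ) → (H →L[ℂ] H)
  isPositive : ∀ X, MeasurableSet X → (toFun X).IsPositive
  univ_eq_one : toFun Set.univ = 1
  /-- `σ`-additivity in the weak operator topology -/
  hasSum_iUnion : ∀ X : ℕ → Set (Fin M → ℝ), (∀ j, MeasurableSet (X j)) →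
    Pairwise (Function.onFun Disjoint X) →
      ∀ φ ψ : H, HasSum (fun j => ⟪φ, toFun (X j) ψ⟫_ℂ) ⟪φ, toFun (⋃ j, X j) ψ⟫_ℂ

namespace Observable

variable {M : ℕ} {H : Type*} [NormedAddCommGroup H] [InnerProductSpace ℂ H]

/-- The finite positive measure `X ↦ ⟨φ, E(X) φ⟩` on `ℝ^M`. -/
def diagMeasure (E : Observable M H) (φ : H) : Measure (Fin M → ℝ) :=
  Measure.ofMeasurable (fun X _ => ENNReal.ofReal (⟪φ, E.toFun X φ⟫_ℂ).re)
    (by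
      have h := E.hasSum_iUnion (fun _ => ∅) (fun _ => MeasurableSet.empty)
        (fun _ _ _ => by simp [Function.onFun]) φ φ
      have h0 : ⟪φ, E.toFun ∅ φ⟫_ℂ = 0 := by
        simpa using tendsto_nhds_unique tendsto_const_nhds h.summable.tendsto_atTop_zero
      simp [h0])
    (by
      intro X hX hd
      have h := Complex.hasSum_re (E.hasSum_iUnion X hX hd φ φ)
      have hnn : ∀ j, 0 ≤ (⟪φ, E.toFun (X j) φ⟫_ℂ).re := fun j =>
        (E.isPositive (X j) (hX j)).re_inner_nonneg_right φ
      rw [← h.tsum_eq, ENNReal.ofReal_tsum_of_nonneg hnn h.summable])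

/-- `E.HasCharFun F` says that `F` is the characteristic function
`F(p) = ∫ exp(i pᵀx) E(dx)` of the observable `E`, the operator integral being understood weakly:
`⟨φ, F(p) φ⟩ = ∫ exp(i pᵀx) ⟨φ, E(dx) φ⟩` for all vectors `φ`. By polarization this
determines the operator `F(p)`. -/
def HasCharFun (E : Observable M H) (F : (Fin M → ℝ) → (H →L[ℂ] H)) : Prop :=
  ∀ (p : Fin M → ℝ) (φ : H),
    ⟪φ, F p φ⟫_ℂ = ∫ x, Complex.exp (Complex.I * ((p ⬝ᵥ x : ℝ) : ℂ)) ∂(E.diagMeasure φ)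

variable [CompleteSpace H]

/-- The outcome distribution `X ↦ tr(ρ E(X))` of `E` in the state `ρ`. -/
def outcomeDist (E : Observable M H) (ρ : H →L[ℂ] H) (X : Set (Fin M → ℝ)) : ℂ :=
  trace (ρ * E.toFun X)

/-- `E` is informationally complete if every state is uniquely determined by its outcome
distribution. -/
def InformationallyComplete (E : Observable M H) : Prop :=
  ∀ ρ σ : H →L[ℂ] H, IsState ρ → IsState σ →
    (∀ X, MeasurableSet X → E.outcomeDist ρ X = E.outcomeDist σ X) → ρ = σ

end Observable

/-! ### The `N`-mode system and its Weyl operators -/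

/-- The Hilbert space `L²(ℝ^N)` of `N` bosonic modes in the coordinate representation. -/
abbrev ModeSpace (N : ℕ) : Type :=
  Lp ℂ 2 (volume : Measure (Fin N → ℝ))

/-- The phase space `ℝ^{2N}`, with coordinates `(q₁, p₁, …, q_N, p_N)`:
`x (j, 0)` is `q_j` and `x (j, 1)` is `p_j`. -/
abbrev PhaseSpace (N : ℕ) : Type :=
  Fin N × Fin 2 → ℝ

/-- The symplectic matrix `Ω`, the direct sum of `N` copies of `!![0, 1; -1, 0]`. -/
def Omega (N : ℕ) : Matrix (Fin N × Fin 2) (Fin N × Fin 2) ℝ :=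
  (1 : Matrix (Fin N) (Fin N) ℝ) ⊗ₖ !![0, 1; -1, 0]

section Weyl

variable {N : ℕ}

lemma memLp_phase_mul {c : (Fin N → ℝ) → ℝ} (hc : Continuous c) (ψ : ModeSpace N) :
    MemLp (fun t => Complex.exp (Complex.I * (c t : ℂ)) * ψ t) 2
      (volume : Measure (Fin N → ℝ)) := by
  refine (Lp.memLp ψ).of_le (AEStronglyMeasurable.mul
    (Continuous.aestronglyMeasurable (by fun_prop)) (Lp.aestronglyMeasurable ψ))
    (Filter.Eventually.of_forall fun t => ?_)
  rw [norm_mul, mul_comm Complex.I, Complex.norm_exp_ofReal_mul_I, one_mul]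

/-- Multiplication by the phase function `t ↦ exp(i c(t))`, an isometry of `L²(ℝ^N)`. -/
def phaseMul (c : (Fin N → ℝ) → ℝ) (hc : Continuous c) : ModeSpace N →ₗᵢ[ℂ] ModeSpace N where
  toFun ψ := (memLp_phase_mul hc ψ).toLp _
  map_add' ψ χ := by
    rw [← MemLp.toLp_add]
    refine MemLp.toLp_congr _ _ ?_
    filter_upwards [Lp.coeFn_add ψ χ] with t ht
    simp only [ht, Pi.add_apply, mul_add]
  map_smul' a ψ := by
    rw [RingHom.id_apply, ← MemLp.toLp_const_smul]
    refine MemLp.toLp_congr _ _ ?_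
    filter_upwards [Lp.coeFn_smul a ψ] with t ht
    simp only [ht, Pi.smul_apply, smul_eq_mul]
    ring
  norm_map' ψ := by
    have h : ∀ᵐ t, ‖(memLp_phase_mul hc ψ).toLp _ t‖ = ‖ψ t‖ := by
      filter_upwards [(memLp_phase_mul hc ψ).coeFn_toLp] with t ht
      rw [ht, norm_mul, mul_comm Complex.I, Complex.norm_exp_ofReal_mul_I, one_mul]
    exact le_antisymm (Lp.norm_le_norm_of_ae_le (h.mono fun t ht => ht.le))
      (Lp.norm_le_norm_of_ae_le (h.mono fun t ht => ht.ge))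

/-- Translation `ψ ↦ ψ(· - q)`, an isometry of `L²(ℝ^N)`. -/
def translation (q : Fin N → ℝ) : ModeSpace N →ₗᵢ[ℂ] ModeSpace N :=
  Lp.compMeasurePreservingₗᵢ ℂ (fun t => t - q) (measurePreserving_sub_right volume q)

/-- The Weyl operator `W(x) = exp(-i xᵀ Ω R) = exp(i ∑ⱼ (pⱼ Qⱼ - qⱼ Pⱼ))` for
`x = (q₁, p₁, …, q_N, p_N)`, where `Qⱼ` is multiplication by the `j`-th coordinate and
`Pⱼ = -i ∂ⱼ`. In the coordinate representation
`(W(x) ψ)(t) = exp(i (p · t - q · p / 2)) ψ(t - q)`. -/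
def weyl (x : PhaseSpace N) : ModeSpace N →L[ℂ] ModeSpace N :=
  (phaseMul (fun t => ∑ j, (x (j, 1) * t j - x (j, 0) * x (j, 1) / 2))
      (by fun_prop)).toContinuousLinearMap ∘L
    (translation fun j => x (j, 0)).toContinuousLinearMap

lemma weyl_apply_ae (x : PhaseSpace N) (ψ : ModeSpace N) :
    weyl x ψ =ᵐ[volume] fun t =>
      Complex.exp (Complex.I * ((∑ j, (x (j, 1) * t j - x (j, 0) * x (j, 1) / 2) : ℝ) : ℂ)) *
        ψ (t - fun j => x (j, 0)) := by
  have h1 := (memLp_phase_mul (N := N)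
    (c := fun t => ∑ j, (x (j, 1) * t j - x (j, 0) * x (j, 1) / 2)) (by fun_prop)
    (translation (fun j => x (j, 0)) ψ)).coeFn_toLp
  have h2 := Lp.coeFn_compMeasurePreserving ψ
    (measurePreserving_sub_right volume (fun j => x (j, 0)))
  filter_upwards [h1, h2] with t ht1 ht2
  exact ht1.trans (congrArg _ ht2)

/-- The Weyl relation `W(x) W(y) = exp(-(i/2) xᵀ Ω y) W(x + y)`. -/
lemma weyl_mul (x y : PhaseSpace N) :
    weyl x * weyl y =
      Complex.exp (-(Complex.I / 2) * ((x ⬝ᵥ Omega N *ᵥ y : ℝ) : ℂ)) • weyl (x + y) := by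
  ext1 ψ
  refine Lp.ext ?_
  have h1 := weyl_apply_ae x (weyl y ψ)
  have h2 := (measurePreserving_sub_right volume
    (fun j => x (j, 0))).quasiMeasurePreserving.tendsto_ae.eventually (weyl_apply_ae y ψ)
  have h3 := weyl_apply_ae (x + y) ψ
  have h4 := Lp.coeFn_smul
    (Complex.exp (-(Complex.I / 2) * ((x ⬝ᵥ Omega N *ᵥ y : ℝ) : ℂ))) (weyl (x + y) ψ)
  filter_upwards [h1, h2, h3, h4] with t h1 h2 h3 h4
  have hΩ : x ⬝ᵥ Omega N *ᵥ y = ∑ j, (x (j, 0) * y (j, 1) - x (j, 1) * y (j, 0)) := by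
    simp only [Omega, dotProduct, Matrix.mulVec, Fintype.sum_prod_type, Matrix.one_apply,
      Matrix.kroneckerMap_apply, Fin.sum_univ_two]
    refine Finset.sum_congr rfl fun j _ => ?_
    simp [sub_eq_add_neg]
  have hq : (t - fun j => x (j, 0)) - (fun j => y (j, 0)) = t - fun j => (x + y) (j, 0) := by
    ext j
    simp [sub_sub]
  refine h1.trans (Eq.trans ?_ h4.symm)
  rw [h2, Pi.smul_apply, h3, hq, hΩ, smul_eq_mul, ← mul_assoc, ← mul_assoc,
    ← Complex.exp_add, ← Complex.exp_add]
  congr 2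
  push_cast
  simp only [Finset.mul_sum, ← Finset.sum_add_distrib]
  refine Finset.sum_congr rfl fun j _ => ?_
  simp only [Pi.sub_apply, Pi.add_apply]
  push_cast
  ring

end Weyl

/-! ### Gaussian observables -/

/-- `E` is a Gaussian observable with parameters `(A₀, B₀, v₀)`: these satisfy
`B₀ - i A₀ᵀ Ω A₀ ≥ 0`, and the characteristic function of `E` is
`p ↦ exp(-(1/4) pᵀ B₀ p - i v₀ᵀ p) W(A₀ p)`. -/
structure IsGaussian {N M : ℕ} (E : Observable M (ModeSpace N))
    (A₀ : Matrix (Fin N × Fin 2) (Fin M) ℝ) (B₀ : Matrix (Fin M) (Fin M) ℝ)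
    (v₀ : Fin M → ℝ) : Prop where
  posSemidef : (B₀.map ((↑) : ℝ → ℂ) -
    Complex.I • (A₀ᵀ * Omega N * A₀).map ((↑) : ℝ → ℂ)).PosSemidef
  hasCharFun : E.HasCharFun fun p =>
    Complex.exp (-(1 / 4) * ((p ⬝ᵥ B₀ *ᵥ p : ℝ) : ℂ) - Complex.I * ((v₀ ⬝ᵥ p : ℝ) : ℂ)) •
      weyl (A₀ *ᵥ p)

end GaussianIC

end

/-! Up to a nonvanishing Gaussian factor, the characteristic function of the outcome distribution in
a state ρ is p ↦ tr(ρ W(A₀p)). So the outcomes carry exactly the information in the Weyl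
expectations on the range of A₀.

If A₀ has rank 2N, all Weyl expectations of two states with equal outcomes agree, and it remains to
see that these determine a state (`IsState.eq_of_trace_mul_weyl`). Write ρ = ∑ |uᵢ⟩⟨uᵢ|. For fixed
position shift q, the expectation of W(q, p) is, up to a phase, the Fourier transform in p of t ↦ ∑
conj(uᵢ(t)) uᵢ(t - q). Fourier uniqueness on L¹ thus recovers the integral kernel on almost all of
each shifted diagonal, and Fubini after a shear recovers all matrix elements.

If the rank is smaller, choose z ≠ 0 orthogonal to the range and y with Ωy = z. Then W(y) commutes
with every W(A₀p), so φ and W(y)φ have the same outcomes. Informational completeness would make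
every unit vector an eigenvector of W(y), hence W(y) a scalar; but W(y) anticommutes with some Weyl
operator (`weyl_ne_smul_one`). -/

namespace GaussianIC

/-! ### Uniqueness of Fourier transforms on `ℝⁿ` -/

section Fourier

variable {n : ℕ}

/-- Finite measures on `ℝⁿ` are determined by their characteristic functions. -/
lemma measure_ext_of_integral_exp {μ ν : Measure (Fin n → ℝ)} [IsFiniteMeasure μ]
    [IsFiniteMeasure ν]
    (h : ∀ p : Fin n → ℝ, ∫ x, Complex.exp (Complex.I * ((p ⬝ᵥ x : ℝ) : ℂ)) ∂μ =
      ∫ x, Complex.exp (Complex.I * ((p ⬝ᵥ x : ℝ) : ℂ)) ∂ν) : μ = ν := by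
  refine ext_of_integral_char_eq (L := dotProductBilin ℝ ℝ)
    Real.continuous_probChar Real.probChar_ne_one (fun v hv h0 => hv ?_) ?_ fun p => ?_
  · exact dotProduct_self_eq_zero.1 (LinearMap.congr_fun h0 v)
  · exact Continuous.dotProduct continuous_fst continuous_snd
  · convert! h p using 4 with x x <;>
    · rw [dotProduct_comm, mul_comm]
      rfl

/-- The positive and negative parts of r are densities of finite measures with the same
characteristic function, so they agree almost everywhere; having disjoint supports, both vanish. -/
lemma ae_eq_zero_of_integral_exp_mul_ofReal {r : (Fin n → ℝ) → ℝ} (hr : Integrable r)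
    (h : ∀ p : Fin n → ℝ, ∫ x, Complex.exp (Complex.I * ((p ⬝ᵥ x : ℝ) : ℂ)) * (r x : ℂ) = 0) :
    r =ᵐ[volume] 0 := by
  have hint (s : (Fin n → ℝ) → ℝ) (hs : Integrable s) (p : Fin n → ℝ) :
      Integrable fun x => ((s x).toNNReal : ℝ) • Complex.exp (Complex.I * ((p ⬝ᵥ x : ℝ) : ℂ)) := by
    refine Integrable.mono hs ?_ (Filter.Eventually.of_forall fun x => ?_)
    · have hc : Continuous fun x : Fin n → ℝ =>
          Complex.exp (Complex.I * ((p ⬝ᵥ x : ℝ) : ℂ)) := by fun_prop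
      have hm := hs.aestronglyMeasurable.aemeasurable.real_toNNReal.coe_nnreal_real
      exact hm.aestronglyMeasurable.smul hc.aestronglyMeasurable
    · rw [norm_smul, mul_comm Complex.I, Complex.norm_exp_ofReal_mul_I, mul_one,
        Real.coe_toNNReal', Real.norm_of_nonneg (le_max_right _ _)]
      exact max_le (le_abs_self _) (abs_nonneg _)
  have hfin (s : (Fin n → ℝ) → ℝ) (hs : Integrable s) :
      IsFiniteMeasure (volume.withDensity fun x => ((s x).toNNReal : ℝ≥0∞)) :=
    isFiniteMeasure_withDensity_ofReal hs.2
  have hm1 := hr.aestronglyMeasurable.aemeasurable.real_toNNReal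
  have hm2 : AEMeasurable (fun x => (- r x).toNNReal) :=
    hr.aestronglyMeasurable.aemeasurable.neg.real_toNNReal
  have := hfin r hr
  have := hfin (fun x => - r x) hr.neg
  have hm : (volume.withDensity fun x => ((r x).toNNReal : ℝ≥0∞)) =
      volume.withDensity fun x => ((- r x).toNNReal : ℝ≥0∞) := by
    refine measure_ext_of_integral_exp fun p => ?_
    rw [integral_withDensity_eq_integral_smul₀ hm1, integral_withDensity_eq_integral_smul₀ hm2,
      ← sub_eq_zero]
    simp only [NNReal.smul_def]
    rw [← integral_sub (hint r hr p) (hint (fun x => - r x) hr.neg p), ← h p]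
    refine integral_congr_ae (Filter.Eventually.of_forall fun x => ?_)
    simp only [Real.coe_toNNReal', Complex.real_smul]
    rw [← sub_mul, ← Complex.ofReal_sub, max_zero_sub_max_neg_zero_eq_self, mul_comm]
  have hne : ∫⁻ x, ((r x).toNNReal : ℝ≥0∞) ≠ ∞ := by
    rw [← setLIntegral_univ, ← withDensity_apply _ MeasurableSet.univ]
    exact measure_ne_top _ _
  have hae := (withDensity_eq_iff hm1.coe_nnreal_ennreal hm2.coe_nnreal_ennreal hne).1 hm
  filter_upwards [hae] with x hx
  have hx' : (r x).toNNReal = (- r x).toNNReal := by exact_mod_cast hx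
  have := max_zero_sub_max_neg_zero_eq_self (r x)
  rw [← Real.coe_toNNReal', ← Real.coe_toNNReal', hx', sub_self] at this
  exact this.symm

/-- An integrable function on `ℝⁿ` with vanishing Fourier transform vanishes almost everywhere. -/
lemma ae_eq_zero_of_integral_exp_mul {h : (Fin n → ℝ) → ℂ} (hh : Integrable h)
    (h0 : ∀ p : Fin n → ℝ, ∫ x, Complex.exp (Complex.I * ((p ⬝ᵥ x : ℝ) : ℂ)) * h x = 0) :
    h =ᵐ[volume] 0 := by
  have hint (g : (Fin n → ℝ) → ℂ) (hg : Integrable g) (p : Fin n → ℝ) :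
      Integrable fun x => Complex.exp (Complex.I * ((p ⬝ᵥ x : ℝ) : ℂ)) * g x := by
    refine hg.mono ((Continuous.aestronglyMeasurable (by fun_prop)).mul hg.aestronglyMeasurable)
      (Filter.Eventually.of_forall fun x => ?_)
    rw [norm_mul, mul_comm Complex.I, Complex.norm_exp_ofReal_mul_I, one_mul]
  have hc : Integrable fun x => (starRingEnd ℂ) (h x) :=
    (RCLike.conjLIE (K := ℂ)).toContinuousLinearEquiv.toContinuousLinearMap.integrable_comp hh
  -- Conjugating the transform at -p shows that conj h has vanishing transform too, hence so do the
  -- real and imaginary parts.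
  have h1 (p : Fin n → ℝ) :
      ∫ x, Complex.exp (Complex.I * ((p ⬝ᵥ x : ℝ) : ℂ)) * (starRingEnd ℂ) (h x) = 0 := by
    rw [← map_zero (starRingEnd ℂ), ← h0 (-p), ← integral_conj]
    refine integral_congr_ae (Filter.Eventually.of_forall fun x => ?_)
    simp [← Complex.exp_conj]
  have hre : (fun x => (h x).re) =ᵐ[volume] 0 := by
    refine ae_eq_zero_of_integral_exp_mul_ofReal hh.re fun p => ?_
    have := congrArg (fun z : ℂ => (1 / 2 : ℂ) * z)
      ((integral_add (hint _ hh p) (hint _ hc p)).trans (by rw [h0, h1, add_zero]))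
    simp only [mul_zero] at this
    rw [← this, ← integral_const_mul]
    refine integral_congr_ae (Filter.Eventually.of_forall fun x => ?_)
    simp only [Complex.re_eq_add_conj]
    ring
  have him : (fun x => (h x).im) =ᵐ[volume] 0 := by
    refine ae_eq_zero_of_integral_exp_mul_ofReal hh.im fun p => ?_
    have := congrArg (fun z : ℂ => (1 / (2 * Complex.I) : ℂ) * z)
      ((integral_sub (hint _ hh p) (hint _ hc p)).trans (by rw [h0, h1, sub_zero]))
    simp only [mul_zero] at this
    rw [← this, ← integral_const_mul]
    refine integral_congr_ae (Filter.Eventually.of_forall fun x => ?_)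
    simp only [Complex.im_eq_sub_conj]
    ring
  filter_upwards [hre, him] with x h1 h2
  exact Complex.ext h1 h2

end Fourier

/-- An absolutely convergent series of integrable functions is integrable. -/
lemma integrable_tsum {α ι : Type*} [MeasurableSpace α] {μ : Measure α} [Countable ι]
    {F : ι → α → ℂ} (hF : ∀ i, Integrable (F i) μ)
    (hs : Summable fun i => ∫ a, ‖F i a‖ ∂μ) : Integrable (fun a => ∑' i, F i a) μ := by
  have hsum : ∑' i, ‖(hF i).toL1 (F i)‖ₑ ≠ ∞ := by
    have (i : ι) : ‖(hF i).toL1 (F i)‖ₑ = ENNReal.ofReal (∫ a, ‖F i a‖ ∂μ) := by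
      rw [← ofReal_norm, L1.norm_of_fun_eq_integral_norm]
    simp_rw [this]
    rw [← ENNReal.ofReal_tsum_of_nonneg (fun i => integral_nonneg fun a => norm_nonneg _) hs]
    exact ENNReal.ofReal_ne_top
  have h1 := Lp.hasSum_coeFn_tsum hsum
  have h2 : ∀ᵐ a ∂μ, ∀ i, (hF i).toL1 (F i) a = F i a :=
    ae_all_iff.2 fun i => (hF i).coeFn_toL1
  refine (L1.integrable_coeFn (∑' i, (hF i).toL1 (F i))).congr ?_
  filter_upwards [h1, h2] with a h1 h2
  simp only [h2] at h1
  exact h1.tsum_eq.symm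

/-! ### Expectations in a state -/

section Trace

variable {H : Type*} [NormedAddCommGroup H] [InnerProductSpace ℂ H]

lemma hasSum_norm_inner_sq {ι : Type*} (b : HilbertBasis ι ℂ H) (x : H) :
    HasSum (fun i => ‖⟪x, b i⟫_ℂ‖ ^ 2) (‖x‖ ^ 2) := by
  have h := Complex.hasSum_re (b.hasSum_inner_mul_inner x x)
  convert! h using 1
  · ext i
    rw [← inner_conj_symm (b i) x, Complex.mul_conj, Complex.normSq_eq_norm_sq, Complex.ofReal_re]
  · rw [inner_self_eq_norm_sq_to_K]
    norm_cast

lemma summable_norm_inner_sq_prod {ι κ : Type*} (b : HilbertBasis ι ℂ H) {u : κ → H}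
    (hu : Summable fun k => ‖u k‖ ^ 2) :
    Summable fun z : κ × ι => ‖⟪u z.1, b z.2⟫_ℂ‖ ^ 2 := by
  rw [summable_prod_of_nonneg (fun z => by positivity)]
  refine ⟨fun k => (hasSum_norm_inner_sq b (u k)).summable, ?_⟩
  simpa only [(hasSum_norm_inner_sq b _).tsum_eq] using hu

variable [CompleteSpace H]

/-- `tr(S² T) = ∑ᵢ ⟨S eᵢ, T S eᵢ⟩` for a self-adjoint Hilbert–Schmidt operator `S`. -/
lemma hasSum_trace_mul_self_mul {S : H →L[ℂ] H} (hS : IsSelfAdjoint S)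
    (hsum : Summable fun i => ‖S (basis H i)‖ ^ 2) (T : H →L[ℂ] H) :
    HasSum (fun i => ⟪S (basis H i), T (S (basis H i))⟫_ℂ) (trace (S * S * T)) := by
  have hsym (x y : H) : ⟪S x, y⟫_ℂ = ⟪x, S y⟫_ℂ :=
    (ContinuousLinearMap.isSelfAdjoint_iff_isSymmetric.1 hS) x y
  let e := basis H
  -- Row sums of F give the diagonal of S²T, column sums give the expectations in S eⱼ. Each entry
  -- is a product of two square-summable arrays, so F is absolutely summable and the order of
  -- summation is irrelevant.
  let F : basisIndex H → basisIndex H → ℂ := fun i j =>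
    ⟪S (e i), e j⟫_ℂ * ⟪e j, S (T (e i))⟫_ℂ
  have hF (i j) : F i j = ⟪T.adjoint (S (e j)), e i⟫_ℂ * ⟪e i, S (e j)⟫_ℂ := by
    simp only [F]
    rw [← hsym (e j), T.adjoint_inner_left, hsym (e i), mul_comm]
  have h1 := summable_norm_inner_sq_prod e hsum
  have h2 : Summable fun z : basisIndex H × basisIndex H =>
      ‖⟪T.adjoint (S (e z.2)), e z.1⟫_ℂ‖ ^ 2 := by
    have : Summable fun i => ‖T.adjoint (S (e i))‖ ^ 2 := by
      refine (hsum.mul_left (‖T.adjoint‖ ^ 2)).of_nonneg_of_le (fun i => by positivity) fun i => ?_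
      rw [← mul_pow]
      gcongr
      exact T.adjoint.le_opNorm _
    exact (summable_norm_inner_sq_prod e this).prod_symm
  have hsF : Summable fun z : basisIndex H × basisIndex H => F z.1 z.2 := by
    refine ((h1.add h2)).of_norm_bounded fun z => ?_
    rw [hF, norm_mul, ← hsym]
    nlinarith [sq_nonneg (‖⟪S (e z.1), e z.2⟫_ℂ‖ - ‖⟪T.adjoint (S (e z.2)), e z.1⟫_ℂ‖),
      sq_nonneg ‖⟪S (e z.1), e z.2⟫_ℂ‖, sq_nonneg ‖⟪T.adjoint (S (e z.2)), e z.1⟫_ℂ‖]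
  have hrow (i) : HasSum (F i) ⟪e i, (S * S * T) (e i)⟫_ℂ := by
    have := e.hasSum_inner_mul_inner (S (e i)) (S (T (e i)))
    rwa [hsym] at this
  have hcol (j) : HasSum (fun i => F i j) ⟪S (e j), T (S (e j))⟫_ℂ := by
    simp only [hF]
    rw [← T.adjoint_inner_left]
    exact e.hasSum_inner_mul_inner _ _
  have htot := hsF.hasSum.prod_fiberwise hrow
  have : trace (S * S * T) = ∑' z : basisIndex H × basisIndex H, F z.1 z.2 := htot.tsum_eq
  rw [this]
  exact ((Equiv.prodComm _ _).hasSum_iff.2 hsF.hasSum).prod_fiberwise hcol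

/-- A state `ρ` is a mixture `∑ᵢ |uᵢ⟩⟨uᵢ|`, and expectations in `ρ` are the sums of
the expectations in the vectors `uᵢ`. -/
lemma IsState.exists_mixture {ρ : H →L[ℂ] H} (hρ : IsState ρ) :
    ∃ u : basisIndex H → H, (Summable fun i => ‖u i‖ ^ 2) ∧
      (∀ T : H →L[ℂ] H, HasSum (fun i => ⟪u i, T (u i)⟫_ℂ) (trace (ρ * T))) ∧
      ∀ f g : H, HasSum (fun i => ⟪u i, f⟫_ℂ * ⟪g, u i⟫_ℂ) ⟪g, ρ f⟫_ℂ := by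
  have hρ0 : 0 ≤ ρ := (ContinuousLinearMap.nonneg_iff_isPositive ρ).2 hρ.isPositive
  obtain ⟨S, hS, hSS⟩ : ∃ S : H →L[ℂ] H, IsSelfAdjoint S ∧ S * S = ρ :=
    ⟨CFC.sqrt ρ, (CFC.sqrt_nonneg ρ).isSelfAdjoint, CFC.sqrt_mul_sqrt_self ρ hρ0⟩
  have hsym (x y : H) : ⟪S x, y⟫_ℂ = ⟪x, S y⟫_ℂ :=
    (ContinuousLinearMap.isSelfAdjoint_iff_isSymmetric.1 hS) x y
  have hsum : Summable fun i => ‖S (basis H i)‖ ^ 2 := by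
    have h := (Complex.hasSum_re hρ.summable.hasSum).summable
    refine h.congr fun i => ?_
    rw [← hSS, mul_apply_eq_comp, ← hsym, inner_self_eq_norm_sq_to_K]
    norm_cast
  refine ⟨fun i => S (basis H i), hsum, fun T => ?_, fun f g => ?_⟩
  · rw [← hSS]
    exact hasSum_trace_mul_self_mul hS hsum T
  · have := (basis H).hasSum_inner_mul_inner (S g) (S f)
    rw [hsym, ← mul_apply_eq_comp, hSS] at this
    refine this.congr_fun fun i => ?_
    rw [hsym, hsym, mul_comm]

/-- The pure state `|φ⟩⟨φ|` has expectations `⟨φ, T φ⟩`. -/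
lemma trace_rankOne_mul (φ : H) (T : H →L[ℂ] H) :
    HasSum (fun i => ⟪basis H i, (InnerProductSpace.rankOne ℂ φ φ * T) (basis H i)⟫_ℂ)
      ⟪φ, T φ⟫_ℂ := by
  have := (basis H).hasSum_inner_mul_inner (T.adjoint φ) φ
  rw [T.adjoint_inner_left] at this
  refine this.congr_fun fun i => ?_
  simp [T.adjoint_inner_left]

lemma isState_rankOne {φ : H} (hφ : ‖φ‖ = 1) : IsState (InnerProductSpace.rankOne ℂ φ φ) := by
  have h := trace_rankOne_mul φ (1 : H →L[ℂ] H)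
  rw [mul_one, one_apply_eq_self, inner_self_eq_norm_sq_to_K, hφ] at h
  refine ⟨?_, h.summable, h.tsum_eq.trans (by simp)⟩
  exact InnerProductSpace.isPositive_rankOne_self φ

end Trace

/-! ### Outcome distributions -/

namespace Observable

variable {M : ℕ} {H : Type*} [NormedAddCommGroup H] [InnerProductSpace ℂ H]

lemma diagMeasure_apply (E : Observable M H) (φ : H) {X : Set (Fin M → ℝ)}
    (hX : MeasurableSet X) :
    E.diagMeasure φ X = ENNReal.ofReal (⟪φ, E.toFun X φ⟫_ℂ).re :=
  Measure.ofMeasurable_apply X hX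

instance isFiniteMeasure_diagMeasure (E : Observable M H) (φ : H) :
    IsFiniteMeasure (E.diagMeasure φ) :=
  ⟨by rw [E.diagMeasure_apply φ MeasurableSet.univ]; exact ENNReal.ofReal_lt_top⟩

lemma ofReal_re_inner (E : Observable M H) (φ : H) {X : Set (Fin M → ℝ)}
    (hX : MeasurableSet X) : (((⟪φ, E.toFun X φ⟫_ℂ).re : ℝ) : ℂ) = ⟪φ, E.toFun X φ⟫_ℂ :=
  Complex.conj_eq_iff_re.1 (by
    rw [inner_conj_symm]
    exact (E.isPositive X hX).isSymmetric φ φ)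

variable [CompleteSpace H]

/-- Two states with the same outcome distributions have the same expectations of the values of
the characteristic function. -/
lemma trace_mul_eq_of_outcomeDist_eq (E : Observable M H) {F : (Fin M → ℝ) → (H →L[ℂ] H)}
    (hF : E.HasCharFun F) {ρ σ : H →L[ℂ] H} (hρ : IsState ρ) (hσ : IsState σ)
    (h : ∀ X, MeasurableSet X → E.outcomeDist ρ X = E.outcomeDist σ X) (p : Fin M → ℝ) :
    trace (ρ * F p) = trace (σ * F p) := by
  obtain ⟨u, -, hu, -⟩ := hρ.exists_mixture
  obtain ⟨v, -, hv, -⟩ := hσ.exists_mixture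
  -- The outcome distribution is the sum of the diagonal measures of the mixture vectors. It is a
  -- finite measure independent of the chosen mixture, so the exponential can be integrated against
  -- it.
  have key {τ : H →L[ℂ] H} {w : basisIndex H → H}
      (hw : ∀ T : H →L[ℂ] H, HasSum (fun i => ⟪w i, T (w i)⟫_ℂ) (trace (τ * T)))
      {X : Set (Fin M → ℝ)} (hX : MeasurableSet X) :
      Measure.sum (fun i => E.diagMeasure (w i)) X = ENNReal.ofReal (E.outcomeDist τ X).re := by
    have hs := Complex.hasSum_re (hw (E.toFun X))
    rw [Measure.sum_apply _ hX, outcomeDist, ← hs.tsum_eq, ENNReal.ofReal_tsum_of_nonneg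
      (f := fun i => (⟪w i, E.toFun X (w i)⟫_ℂ).re)
      (fun i => (E.isPositive X hX).re_inner_nonneg_right (w i)) hs.summable]
    exact tsum_congr fun i => E.diagMeasure_apply (w i) hX
  have hm : Measure.sum (fun i => E.diagMeasure (u i)) =
      Measure.sum (fun i => E.diagMeasure (v i)) :=
    Measure.ext fun X hX => by rw [key hu hX, key hv hX, h X hX]
  have hint {τ : H →L[ℂ] H} {w : basisIndex H → H}
      (hw : ∀ T : H →L[ℂ] H, HasSum (fun i => ⟪w i, T (w i)⟫_ℂ) (trace (τ * T))) :
      trace (τ * F p) = ∫ x, Complex.exp (Complex.I * ((p ⬝ᵥ x : ℝ) : ℂ))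
        ∂(Measure.sum fun i => E.diagMeasure (w i)) := by
    have : IsFiniteMeasure (Measure.sum fun i => E.diagMeasure (w i)) :=
      ⟨by rw [key hw MeasurableSet.univ]; exact ENNReal.ofReal_lt_top⟩
    refine (hw (F p)).unique ?_
    simp only [hF p _]
    refine hasSum_integral_measure (Integrable.of_bound (C := 1)
      (Continuous.aestronglyMeasurable (by fun_prop)) (Filter.Eventually.of_forall fun x => ?_))
    rw [mul_comm Complex.I, Complex.norm_exp_ofReal_mul_I]
  rw [hint hu, hint hv, hm]

end Observable

/-! ### Weyl operators separate trace class operators -/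

section L2

variable {α : Type*} [MeasurableSpace α] {μ : Measure α}

lemma inner_eq_integral_conj_mul (φ ψ : Lp ℂ 2 μ) :
    ⟪φ, ψ⟫_ℂ = ∫ t, (starRingEnd ℂ) (φ t) * ψ t ∂μ := by
  rw [L2.inner_def]
  simp only [RCLike.inner_apply, mul_comm]

lemma integrable_conj_mul (φ ψ : Lp ℂ 2 μ) :
    Integrable (fun t => (starRingEnd ℂ) (φ t) * ψ t) μ := by
  have := L2.integrable_inner (𝕜 := ℂ) φ ψ
  simpa only [RCLike.inner_apply, mul_comm] using this

/-- Cauchy–Schwarz in real L², applied to the pointwise norms of φ and ψ. -/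
lemma integral_norm_conj_mul_le (φ ψ : Lp ℂ 2 μ) :
    ∫ t, ‖(starRingEnd ℂ) (φ t) * ψ t‖ ∂μ ≤ ‖φ‖ * ‖ψ‖ := by
  have hn (χ : Lp ℂ 2 μ) : ‖(Lp.memLp χ).norm.toLp _‖ = ‖χ‖ := by
    rw [Lp.norm_toLp, eLpNorm_norm, Lp.norm_def]
  have h := real_inner_le_norm ((Lp.memLp φ).norm.toLp _) ((Lp.memLp ψ).norm.toLp _)
  rw [hn, hn, L2.inner_def] at h
  refine le_of_eq_of_le (integral_congr_ae ?_) h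
  filter_upwards [(Lp.memLp φ).norm.coeFn_toLp, (Lp.memLp ψ).norm.coeFn_toLp] with t h1 h2
  rw [h1, h2, norm_mul, RCLike.norm_conj]
  simp [mul_comm]

end L2

variable {N : ℕ}

lemma coeFn_translation (q : Fin N → ℝ) (ψ : ModeSpace N) :
    translation q ψ =ᵐ[volume] fun t => ψ (t - q) :=
  Lp.coeFn_compMeasurePreserving ψ (measurePreserving_sub_right volume q)

lemma integrable_conj_mul_translate (φ ψ : ModeSpace N) (q : Fin N → ℝ) :
    Integrable fun t => (starRingEnd ℂ) (φ t) * ψ (t - q) := by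
  refine (integrable_conj_mul φ (translation q ψ)).congr ?_
  filter_upwards [coeFn_translation q ψ] with t ht
  rw [ht]

lemma integral_norm_conj_mul_translate_le (φ ψ : ModeSpace N) (q : Fin N → ℝ) :
    ∫ t, ‖(starRingEnd ℂ) (φ t) * ψ (t - q)‖ ≤ ‖φ‖ * ‖ψ‖ := by
  rw [← (translation q).norm_map ψ]
  refine le_of_eq_of_le (integral_congr_ae ?_) (integral_norm_conj_mul_le φ (translation q ψ))
  filter_upwards [coeFn_translation q ψ] with t ht
  rw [ht]

/-- The phase space point with position `q` and momentum `p`. -/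
def phasePoint (q p : Fin N → ℝ) : PhaseSpace N := fun z => ![q z.1, p z.1] z.2

/-- Matrix elements of Weyl operators, as a Fourier transform in the momentum. -/
lemma inner_weyl_phasePoint (φ ψ : ModeSpace N) (q p : Fin N → ℝ) :
    ⟪φ, weyl (phasePoint q p) ψ⟫_ℂ = Complex.exp (-(Complex.I / 2) * ((q ⬝ᵥ p : ℝ) : ℂ)) *
      ∫ t, Complex.exp (Complex.I * ((p ⬝ᵥ t : ℝ) : ℂ)) *
        ((starRingEnd ℂ) (φ t) * ψ (t - q)) := by
  rw [inner_eq_integral_conj_mul, ← integral_const_mul]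
  refine integral_congr_ae ?_
  filter_upwards [weyl_apply_ae (phasePoint q p) ψ] with t ht
  have h : Complex.exp (Complex.I * ((∑ j, (p j * t j - q j * p j / 2) : ℝ) : ℂ)) =
      Complex.exp (-(Complex.I / 2) * ((q ⬝ᵥ p : ℝ) : ℂ)) *
        Complex.exp (Complex.I * ((p ⬝ᵥ t : ℝ) : ℂ)) := by
    rw [← Complex.exp_add, Finset.sum_sub_distrib, ← Finset.sum_div]
    congr 1
    simp only [dotProduct]
    push_cast
    ring
  rw [ht]
  simp only [phasePoint, Matrix.cons_val_zero, Matrix.cons_val_one]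
  rw [h]
  ring

/-- If the functional `T ↦ ∑ᵢ ⟨aᵢ, T bᵢ⟩` vanishes on the Weyl operators, it vanishes on operators
of rank one. -/
lemma tsum_inner_mul_inner_eq_zero_of_countable {ι : Type*} [Countable ι] {a b : ι → ModeSpace N}
    (hs : Summable fun i => ‖a i‖ * ‖b i‖)
    (h : ∀ x, ∑' i, ⟪a i, weyl x (b i)⟫_ℂ = 0) (f g : ModeSpace N) :
    ∑' i, ⟪a i, f⟫_ℂ * ⟪g, b i⟫_ℂ = 0 := by
  -- The kernel ∑ conj(aᵢ(t)) bᵢ(s) vanishes on almost all of every shifted diagonal s = t - q,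
  -- because its Fourier transform in t is, up to a phase, the sum over i of the Weyl matrix
  -- elements.
  have hk (q : Fin N → ℝ) :
      (fun t => ∑' i, (starRingEnd ℂ) (a i t) * b i (t - q)) =ᵐ[volume] 0 := by
    have hsum : Summable fun i => ∫ t, ‖(starRingEnd ℂ) (a i t) * b i (t - q)‖ :=
      hs.of_nonneg_of_le (fun i => integral_nonneg fun t => norm_nonneg _)
        fun i => integral_norm_conj_mul_translate_le (a i) (b i) q
    refine ae_eq_zero_of_integral_exp_mul
      (integrable_tsum (fun i => integrable_conj_mul_translate (a i) (b i) q) hsum) fun p => ?_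
    have hexp (z : ℂ) (t : Fin N → ℝ) :
        ‖Complex.exp (Complex.I * ((p ⬝ᵥ t : ℝ) : ℂ)) * z‖ = ‖z‖ := by
      rw [norm_mul, mul_comm Complex.I, Complex.norm_exp_ofReal_mul_I, one_mul]
    have h1 := (hasSum_integral_of_summable_integral_norm (μ := volume)
      (F := fun i t => Complex.exp (Complex.I * ((p ⬝ᵥ t : ℝ) : ℂ)) *
        ((starRingEnd ℂ) (a i t) * b i (t - q)))
      (fun i => by
        have hi := integrable_conj_mul_translate (a i) (b i) q
        refine hi.mono ((Continuous.aestronglyMeasurable (by fun_prop)).mul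
          hi.aestronglyMeasurable) (Filter.Eventually.of_forall fun t => (hexp _ t).le))
      (by simpa only [hexp] using hsum)).tsum_eq
    simp only [tsum_mul_left] at h1
    rw [← h1]
    have h2 := h (phasePoint q p)
    simp only [inner_weyl_phasePoint] at h2
    rw [tsum_mul_left] at h2
    exact (mul_eq_zero.1 h2).resolve_left (Complex.exp_ne_zero _)
  let Φ : ι → (Fin N → ℝ) × (Fin N → ℝ) → ℂ := fun i z =>
    ((starRingEnd ℂ) (a i z.1) * f z.1) * ((starRingEnd ℂ) (g z.2) * b i z.2)
  have hΦ (i : ι) : Integrable (Φ i) (volume.prod volume) :=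
    (integrable_conj_mul (a i) f).mul_prod (integrable_conj_mul g (b i))
  have hΦs : Summable fun i => ∫ z, ‖Φ i z‖ ∂(volume.prod volume) := by
    refine (hs.mul_left (‖f‖ * ‖g‖)).of_nonneg_of_le
      (fun i => integral_nonneg fun t => norm_nonneg _) fun i => ?_
    simp only [Φ, norm_mul (_ * _) (_ * _)]
    rw [integral_prod_mul (fun t => ‖(starRingEnd ℂ) (a i t) * f t‖)
      (fun t => ‖(starRingEnd ℂ) (g t) * b i t‖)]
    calc _ ≤ (‖a i‖ * ‖f‖) * (‖g‖ * ‖b i‖) :=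
          mul_le_mul (integral_norm_conj_mul_le _ _) (integral_norm_conj_mul_le _ _)
            (integral_nonneg fun t => norm_nonneg _) (by positivity)
      _ = _ := by ring
  have hval (i : ι) : ∫ z, Φ i z ∂(volume.prod volume) = ⟪a i, f⟫_ℂ * ⟪g, b i⟫_ℂ := by
    rw [inner_eq_integral_conj_mul, inner_eq_integral_conj_mul]
    exact integral_prod_mul (fun t => (starRingEnd ℂ) (a i t) * f t)
      (fun t => (starRingEnd ℂ) (g t) * b i t)
  have htot := (hasSum_integral_of_summable_integral_norm hΦ hΦs).tsum_eq
  simp only [hval] at htot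
  -- The shear (t, r) ↦ (t, t + r) turns the double integral into an iterated one whose inner
  -- integral, at fixed r, runs along the diagonal with shift q = -r.
  have hshear : MeasurePreserving (MeasurableEquiv.shearAddRight (Fin N → ℝ))
      (volume.prod volume) (volume.prod volume) := measurePreserving_prod_add volume volume
  have hint : Integrable (fun z => ∑' i, Φ i (MeasurableEquiv.shearAddRight (Fin N → ℝ) z))
      (volume.prod volume) :=
    (hshear.integrable_comp_emb (MeasurableEquiv.measurableEmbedding _)).2
      (integrable_tsum hΦ hΦs)
  rw [htot, ← hshear.integral_comp', integral_prod_symm _ hint]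
  refine integral_eq_zero_of_ae (Filter.Eventually.of_forall fun r => ?_)
  refine integral_eq_zero_of_ae ?_
  filter_upwards [hk (-r)] with t ht
  simp only [sub_neg_eq_add, Pi.zero_apply] at ht
  have : ∀ i, Φ i (MeasurableEquiv.shearAddRight (Fin N → ℝ) (t, r)) =
      (f t * (starRingEnd ℂ) (g (t + r))) * ((starRingEnd ℂ) (a i t) * b i (t + r)) := by
    intro i
    change ((starRingEnd ℂ) (a i t) * f t) * ((starRingEnd ℂ) (g (t + r)) * b i (t + r)) = _
    ring
  simp only [this, tsum_mul_left, ht, mul_zero, Pi.zero_apply]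

/-- The index set of the abstract Hilbert basis is not known to be countable, but summability leaves
only countably many nonzero terms. -/
lemma tsum_inner_mul_inner_eq_zero_of_weyl {ι : Type*} {a b : ι → ModeSpace N}
    (hs : Summable fun i => ‖a i‖ * ‖b i‖)
    (h : ∀ x, ∑' i, ⟪a i, weyl x (b i)⟫_ℂ = 0) (f g : ModeSpace N) :
    ∑' i, ⟪a i, f⟫_ℂ * ⟪g, b i⟫_ℂ = 0 := by
  let s := Function.support fun i => ‖a i‖ * ‖b i‖
  have : Countable s := hs.countable_support.to_subtype
  have hz {i : ι} (hi : i ∉ s) : a i = 0 ∨ b i = 0 := by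
    simpa [s, or_iff_not_imp_left] using hi
  have key := tsum_inner_mul_inner_eq_zero_of_countable (a := fun i : s => a i)
    (b := fun i : s => b i) (hs.subtype s) (fun x => ?_) f g
  · rw [← key]
    refine (tsum_subtype_eq_of_support_subset (f := fun i => ⟪a i, f⟫_ℂ * ⟪g, b i⟫_ℂ)
      fun i hi => ?_).symm
    by_contra hi'
    rcases hz hi' with h0 | h0 <;> simp [h0] at hi
  · rw [← h x]
    refine tsum_subtype_eq_of_support_subset (f := fun i => ⟪a i, weyl x (b i)⟫_ℂ)
      fun i hi => ?_
    by_contra hi'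
    rcases hz hi' with h0 | h0 <;> simp [h0] at hi

/-- A state is determined by the expectations of the Weyl operators. -/
lemma IsState.eq_of_trace_mul_weyl {ρ σ : ModeSpace N →L[ℂ] ModeSpace N} (hρ : IsState ρ)
    (hσ : IsState σ) (h : ∀ x, trace (ρ * weyl x) = trace (σ * weyl x)) : ρ = σ := by
  obtain ⟨u, hu, hu1, hu2⟩ := hρ.exists_mixture
  obtain ⟨v, hv, hv1, hv2⟩ := hσ.exists_mixture
  -- The difference ρ - σ is encoded as one family over the disjoint union, with the sign placed on
  -- the second copy of v.
  have hs : Summable fun i => ‖Sum.elim u v i‖ * ‖Sum.elim u (-v) i‖ := by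
    refine (HasSum.sum (a := ∑' i, ‖u i‖ ^ 2) (b := ∑' i, ‖v i‖ ^ 2) ?_ ?_).summable
    · simpa [Function.comp_def, sq] using hu.hasSum
    · simpa [Function.comp_def, sq] using hv.hasSum
  have hw (x : PhaseSpace N) : ∑' i, ⟪Sum.elim u v i, weyl x (Sum.elim u (-v) i)⟫_ℂ = 0 := by
    rw [← sub_self (trace (ρ * weyl x)), sub_eq_add_neg]
    refine (HasSum.sum ?_ ?_).tsum_eq
    · simpa [Function.comp_def] using hu1 (weyl x)
    · rw [h x]
      simpa [Function.comp_def] using (hv1 (weyl x)).neg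
  ext1 f
  refine ext_inner_left ℂ fun g => ?_
  rw [← sub_eq_zero, ← tsum_inner_mul_inner_eq_zero_of_weyl hs hw f g, sub_eq_add_neg]
  refine (HasSum.tsum_eq (HasSum.sum ?_ ?_)).symm
  · simpa [Function.comp_def] using hu2 f g
  · simpa [Function.comp_def] using (hv2 f g).neg

/-! ### Commutation of Weyl operators -/

section WeylCommutation

variable {N : ℕ}

lemma dotProduct_Omega_mulVec (x y : PhaseSpace N) :
    x ⬝ᵥ Omega N *ᵥ y = ∑ j, (x (j, 0) * y (j, 1) - x (j, 1) * y (j, 0)) := by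
  simp only [Omega, dotProduct, Matrix.mulVec, Fintype.sum_prod_type, Matrix.one_apply,
    Matrix.kroneckerMap_apply, Fin.sum_univ_two]
  refine Finset.sum_congr rfl fun j _ => ?_
  simp [sub_eq_add_neg]

lemma dotProduct_Omega_mulVec_swap (x y : PhaseSpace N) :
    y ⬝ᵥ Omega N *ᵥ x = -(x ⬝ᵥ Omega N *ᵥ y) := by
  rw [dotProduct_Omega_mulVec, dotProduct_Omega_mulVec, ← Finset.sum_neg_distrib]
  exact Finset.sum_congr rfl fun j _ => by ring

/-- `Ω` is invertible. -/
lemma exists_Omega_mulVec_eq (z : PhaseSpace N) :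
    ∃ y : PhaseSpace N, ∀ x, x ⬝ᵥ Omega N *ᵥ y = x ⬝ᵥ z := by
  -- This is y = Ω⁻¹z, with Ω⁻¹ = -Ω.
  refine ⟨phasePoint (fun j => - z (j, 1)) (fun j => z (j, 0)), fun x => ?_⟩
  rw [dotProduct_Omega_mulVec]
  simp [phasePoint, dotProduct, Fintype.sum_prod_type]

lemma inner_weyl_weyl (x : PhaseSpace N) (φ ψ : ModeSpace N) :
    ⟪weyl x φ, weyl x ψ⟫_ℂ = ⟪φ, ψ⟫_ℂ :=
  ((phaseMul _ (by fun_prop)).inner_map_map _ _).trans ((translation _).inner_map_map _ _)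

lemma norm_weyl (x : PhaseSpace N) (φ : ModeSpace N) : ‖weyl x φ‖ = ‖φ‖ :=
  ((phaseMul _ (by fun_prop)).norm_map _).trans ((translation _).norm_map _)

lemma weyl_mul_comm (x y : PhaseSpace N) (h : x ⬝ᵥ Omega N *ᵥ y = 0) :
    weyl x * weyl y = weyl y * weyl x := by
  rw [weyl_mul, weyl_mul, dotProduct_Omega_mulVec_swap x y, h, neg_zero, add_comm]

instance nontrivial_modeSpace : Nontrivial (ModeSpace N) := by
  have hfin : volume (Metric.ball (0 : Fin N → ℝ) 1) ≠ ∞ := measure_ball_lt_top.ne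
  have hpos : 0 < volume (Metric.ball (0 : Fin N → ℝ) 1) :=
    Metric.measure_ball_pos _ _ one_pos
  refine ⟨indicatorConstLp 2 measurableSet_ball hfin (1 : ℂ), 0, fun h => ?_⟩
  have := congrArg norm h
  rw [norm_indicatorConstLp (by simp) (by simp), norm_zero, norm_one, one_mul] at this
  exact (Real.rpow_pos_of_pos (ENNReal.toReal_pos hpos.ne' hfin) _).ne' this

/-- A Weyl operator is not a multiple of the identity unless its argument vanishes. -/
lemma weyl_ne_smul_one {y z : PhaseSpace N} (hz : z ≠ 0)
    (hy : ∀ x, x ⬝ᵥ Omega N *ᵥ y = x ⬝ᵥ z) (c : ℂ) : weyl y ≠ c • 1 := by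
  intro hc
  have hzz : z ⬝ᵥ z ≠ 0 := fun h => hz (dotProduct_self_eq_zero.1 h)
  -- The scaling makes xᵀΩy = π, so the two Weyl phases are -i and i: W(x) and W(y) anticommute,
  -- whereas a scalar would commute.
  let x : PhaseSpace N := (Real.pi / (z ⬝ᵥ z)) • z
  have hx : x ⬝ᵥ Omega N *ᵥ y = Real.pi := by
    rw [hy, smul_dotProduct, smul_eq_mul, div_mul_cancel₀ _ hzz]
  have h1 : weyl x * weyl y = weyl y * weyl x := by simp [hc]
  rw [weyl_mul, weyl_mul, dotProduct_Omega_mulVec_swap x y, hx, add_comm y x] at h1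
  have e1 : Complex.exp (-(Complex.I / 2) * ((Real.pi : ℝ) : ℂ)) = -Complex.I := by
    rw [show -(Complex.I / 2) * ((Real.pi : ℝ) : ℂ) = -((Real.pi : ℂ) / 2 * Complex.I) by ring,
      Complex.exp_neg, Complex.exp_pi_div_two_mul_I, Complex.inv_I]
  have e2 : Complex.exp (-(Complex.I / 2) * ((-Real.pi : ℝ) : ℂ)) = Complex.I := by
    rw [show -(Complex.I / 2) * ((-Real.pi : ℝ) : ℂ) = (Real.pi : ℂ) / 2 * Complex.I by
      push_cast; ring, Complex.exp_pi_div_two_mul_I]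
  rw [e1, e2, ← sub_eq_zero, ← sub_smul] at h1
  obtain ⟨φ, hφ⟩ := exists_ne (0 : ModeSpace N)
  have h2 : weyl (x + y) φ = 0 := by
    have h3 : weyl (x + y) = 0 := (smul_eq_zero.1 h1).resolve_left (by
      intro h
      have := congrArg Complex.im h
      norm_num at this)
    simp [h3]
  have h4 := norm_weyl (x + y) φ
  rw [h2, norm_zero] at h4
  exact hφ (norm_eq_zero.1 h4.symm)

end WeylCommutation

/-- If the pure states of `φ` and `ψ` agree, then `ψ` is a multiple of `φ`. -/
lemma eq_smul_of_rankOne_eq {H : Type*} [NormedAddCommGroup H] [InnerProductSpace ℂ H]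
    {φ ψ : H} (hψ : ‖ψ‖ = 1)
    (h : InnerProductSpace.rankOne ℂ φ φ = InnerProductSpace.rankOne ℂ ψ ψ) :
    ψ = ⟪φ, ψ⟫_ℂ • φ := by
  have h1 := congrArg (fun T : H →L[ℂ] H => T ψ) h
  simp only [InnerProductSpace.rankOne_apply, inner_self_eq_norm_sq_to_K, hψ] at h1
  simpa using h1.symm

/-- A linear map that maps every unit vector to a multiple of itself is a multiple of the
identity. -/
lemma exists_eq_smul_one_of_forall_norm_eq_one {H : Type*} [NormedAddCommGroup H]
    [InnerProductSpace ℂ H] {T : H →L[ℂ] H}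
    (h : ∀ φ : H, ‖φ‖ = 1 → ∃ c : ℂ, T φ = c • φ) : ∃ c : ℂ, T = c • 1 := by
  have hT : ∀ φ : H, ¬ LinearIndependent ℂ ![φ, (T : H →ₗ[ℂ] H) φ] := by
    intro φ hφ
    have h0 : φ ≠ 0 := hφ.ne_zero 0
    obtain ⟨c, hc⟩ := h (((‖φ‖⁻¹ : ℝ) : ℂ) • φ) (by
      rw [norm_smul, Complex.norm_real, norm_inv, norm_norm,
        inv_mul_cancel₀ (norm_ne_zero_iff.2 h0)])
    have hn : ((‖φ‖⁻¹ : ℝ) : ℂ) ≠ 0 := by simpa using h0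
    rw [map_smul, smul_comm] at hc
    have hc' : T φ = c • φ := smul_right_injective H hn hc
    have := (LinearIndependent.pair_iff.1 hφ) c (-1) (by simp [hc'])
    simp at this
  obtain ⟨c, hc⟩ := LinearMap.exists_eq_smul_id_of_forall_notLinearIndependent hT
  exact ⟨c, ContinuousLinearMap.ext fun φ => LinearMap.congr_fun hc φ⟩

/-! ### Informational completeness of Gaussian observables -/

section Gaussian

variable {N M : ℕ} {A₀ : Matrix (Fin N × Fin 2) (Fin M) ℝ} {B₀ : Matrix (Fin M) (Fin M) ℝ}
  {v₀ : Fin M → ℝ} {E : Observable M (ModeSpace N)}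

lemma IsGaussian.informationallyComplete (hE : IsGaussian E A₀ B₀ v₀)
    (hA : ∀ x : PhaseSpace N, ∃ p, A₀ *ᵥ p = x) : E.InformationallyComplete := by
  intro ρ σ hρ hσ h
  refine hρ.eq_of_trace_mul_weyl hσ fun x => ?_
  obtain ⟨p, rfl⟩ := hA x
  have := E.trace_mul_eq_of_outcomeDist_eq hE.hasCharFun hρ hσ h p
  simp only [trace, mul_smul_comm, smul_apply, inner_smul_right,
    tsum_mul_left] at this
  exact mul_left_cancel₀ (Complex.exp_ne_zero _) this

/-- Outcome distributions do not change under displacements symplectically orthogonal to the range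
of `A₀`. -/
lemma IsGaussian.inner_weyl_toFun_weyl (hE : IsGaussian E A₀ B₀ v₀) {y : PhaseSpace N}
    (hy : ∀ p, (A₀ *ᵥ p) ⬝ᵥ Omega N *ᵥ y = 0) (φ : ModeSpace N) {X : Set (Fin M → ℝ)}
    (hX : MeasurableSet X) :
    ⟪weyl y φ, E.toFun X (weyl y φ)⟫_ℂ = ⟪φ, E.toFun X φ⟫_ℂ := by
  have hm : E.diagMeasure (weyl y φ) = E.diagMeasure φ := by
    refine measure_ext_of_integral_exp fun p => ?_
    rw [← hE.hasCharFun p, ← hE.hasCharFun p]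
    simp only [smul_apply, inner_smul_right]
    -- Since W(y) commutes with W(A₀p) and is isometric, it drops out of the expectation.
    rw [← mul_apply_eq_comp, weyl_mul_comm _ _ (hy p), mul_apply_eq_comp, inner_weyl_weyl]
  have h := congrArg (fun μ => μ X) hm
  simp only [E.diagMeasure_apply _ hX] at h
  have h' := (ENNReal.ofReal_eq_ofReal_iff ((E.isPositive X hX).re_inner_nonneg_right _)
    ((E.isPositive X hX).re_inner_nonneg_right _)).1 h
  rw [← E.ofReal_re_inner _ hX, ← E.ofReal_re_inner φ hX]
  exact congrArg _ h'

lemma IsGaussian.not_informationallyComplete (hE : IsGaussian E A₀ B₀ v₀) {z : PhaseSpace N}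
    (hz : z ≠ 0) (hzA : ∀ p, (A₀ *ᵥ p) ⬝ᵥ z = 0) : ¬ E.InformationallyComplete := by
  intro hIC
  obtain ⟨y, hy⟩ := exists_Omega_mulVec_eq z
  obtain ⟨c, hc⟩ := exists_eq_smul_one_of_forall_norm_eq_one (T := weyl y) fun φ hφ => by
    have hWφ : ‖weyl y φ‖ = 1 := (norm_weyl y φ).trans hφ
    refine ⟨_, eq_smul_of_rankOne_eq hWφ
      (hIC _ _ (isState_rankOne hφ) (isState_rankOne hWφ) fun X hX => ?_)⟩
    refine (trace_rankOne_mul φ (E.toFun X)).tsum_eq.trans (Eq.trans ?_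
      (trace_rankOne_mul (weyl y φ) (E.toFun X)).tsum_eq.symm)
    exact (hE.inner_weyl_toFun_weyl (fun p => (hy _).trans (hzA p)) φ hX).symm
  exact weyl_ne_smul_one hz hy c hc

end Gaussian

/-- If the rank of `A` is not maximal, some nonzero vector is orthogonal to the range of `A`. -/
lemma exists_ne_zero_forall_mulVec_dotProduct_eq_zero {m n : Type*} [Fintype m] [Fintype n]
    [DecidableEq m] (A : Matrix m n ℝ) (hA : LinearMap.range A.mulVecLin ≠ ⊤) :
    ∃ z : m → ℝ, z ≠ 0 ∧ ∀ p, (A *ᵥ p) ⬝ᵥ z = 0 := by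
  -- A proper subspace lies in the kernel of a nonzero functional, which the dot product represents
  -- by a vector.
  obtain ⟨f, hf, hle⟩ := Submodule.exists_le_ker_of_lt_top _ hA.lt_top
  obtain ⟨z, rfl⟩ := (dotProductEquiv ℝ m).surjective f
  refine ⟨z, fun h => hf (by rw [h, map_zero]), fun p => ?_⟩
  rw [dotProduct_comm]
  exact hle ⟨p, rfl⟩

end GaussianIC

theorem mainTheorem3 {N M : ℕ} (A₀ : Matrix (Fin N × Fin 2) (Fin M) ℝ)
    (B₀ : Matrix (Fin M) (Fin M) ℝ) (v₀ : Fin M → ℝ)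
    (E : GaussianIC.Observable M (GaussianIC.ModeSpace N))
    (hE : GaussianIC.IsGaussian E A₀ B₀ v₀) :
    E.InformationallyComplete ↔ A₀.rank = 2 * N := by
  have hdim : Module.finrank ℝ (GaussianIC.PhaseSpace N) = 2 * N := by
    simp [mul_comm]
  have hrank : A₀.rank = 2 * N ↔ LinearMap.range A₀.mulVecLin = ⊤ := by
    rw [Matrix.rank, ← hdim]
    exact ⟨Submodule.eq_top_of_finrank_eq, fun h => by rw [h, finrank_top]⟩
  rw [hrank]
  refine ⟨fun h => ?_, fun h => hE.informationallyComplete fun x => ?_⟩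
  · by_contra hA
    obtain ⟨z, hz, hzA⟩ :=
      GaussianIC.exists_ne_zero_forall_mulVec_dotProduct_eq_zero A₀ hA
    exact hE.not_informationallyComplete hz hzA h
  · exact LinearMap.range_eq_top.1 h x
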